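/- **Conventions.** $|\cdot|$ is the Euclidean norm, "smooth" means $C^\infty$, and $W$ always denotes a closed bounded (possibly empty) set. Let $g:\mathbb R\setminus W\to\mathbb R$ be smooth. It is *analytic at infinity* if there are $\epsilon_1,\epsilon_2>0$ and real $(a_n)_{n\ge1},(b_n)_{n\ge 1}$ with $g(1/x)=\sum_{n\ge1}a_nx^n$ for $0<x<\epsilon_1$ and $g(1/x)=\sum_{n\ge1}b_nx^n$ for $-\epsilon_2<x<0$, both series converging absolutely there (and $1/x\notin W$ for these $x$). A function $f:\mathbb R^d\setminus W\to\mathbb R$ is of *moderate decrease $n$* if there is $C>0$ with $|f(p)|\le C/|p|^n$ for all $p\notin W$ with $|p|>1$; for $n=1$ it is said to be of *very moderate decrease*, for $n=2$ of *moderate decrease*. Subscripts denote fixed variables, e.g. $f_x(y)=f(x,y)$ on $\{y:(x,y)\notin W\}$ and $f_{x,y}(z)=f(x,y,z)$ on $\{z:(x,y,z)\notin W\}$; zeros are counted in these domains. **Two variables.** Let $f:\mathbb R^2\setminus W\to\mathbb R$ be smooth, and consider: (a) for all $x$ and all $y$ in $\mathbb R$, $f_x$ and $f_y$ are analytic at infinity;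 (b) $f$ is of very moderate decrease; (c) $\partial f/\partial x$ and $\partial f/\partial y$ are of moderate decrease. * $f$ is *normal* if (a)–(c) hold and the numbers of zeros of $f_x,f_x',f_x''$ and $f_y,f_y',f_y''$ are bounded uniformly in $x$ and $y$. * $f$ is *quasi normal* if (a)–(c) hold and there are $K,R\in\mathbb R$ such that for $|x|>K$ the zeros of each of $f_x,f_x',f_x''$ lie in a set $(-M,-N)\cup(N,M)$ with real $N<M$, $M-N\le R$ ($M,N$ may depend on $x$ and on the function), and similarly for $f_y,f_y',f_y''$ with $|y|>K$. * $f$ is *quasi split normal* if (a)–(c) hold and there are a closed bounded $W'\supseteq W$ and (smooth) quasi normal $f_1,f_2:\mathbb R^2\setminus W'\to\mathbb R$ with $f=f_1+f_2$ on $\mathbb R^2\setminus W'$. **Three variables.** Let $f:\mathbb R^3\setminus W\to\mathbb R$ be smooth, and consider: (A) $f$ is of very moderate decrease; (B) for all $i,j,k\ge0$ with $i+j+k\ge1$, $\partial^{i+j+k}f/\partial x^i\partial y^j\partial z^k$ is of moderate decrease $i+j+k+1$; (Z) there are $K,R\in\mathbb R$ and $S\in\mathbb N$ such that for $|(x,y)|>K$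 all zeros of $f_{x,y}$ and of its first four derivatives lie in a union of $S$ bounded intervals of total length at most $R$, and similarly for $f_{x,z}$ and $f_{y,z}$. * $f$ is *normal* if (A), (B) hold, every $f_x(y,z)$, $f_y(x,z)$, $f_z(x,y)$ is normal, and the numbers of zeros of $f_{x,y},f_{x,z},f_{y,z}$ and of their first four derivatives are bounded uniformly in the fixed variables. * $f$ is *quasi normal* if (A), (B), (Z) hold and every $f_x$, $f_y$, $f_z$ is quasi normal. * $f$ is *quasi split normal* if (A), (B) hold, every $f_x$, $f_y$, $f_z$ is quasi split normal, and there are a closed bounded $W'\supseteq W$ and smooth $f_1,f_2:\mathbb R^3\setminus W'\to\mathbb R$ satisfying (Z) with $f=f_1+f_2$ on $\mathbb R^3\setminus W'$. **Lemma.** 1. Let $(a,b,c)\in\mathbb R^3$, $s>0$ and let $W$ be the closed ball of radius $s$ around $(a,b,c)$. Then $f(x,y,z)=\dfrac1{|(x,y,z)-(a,b,c)|}$, restricted to $\mathbb R^3\setminus W$, is normal. 2. Let $\rho:\mathbb R^3\to\mathbb R$ be continuous with compact support, $\rho\ge0$, $\rho\ne0$. Then the integral $$f(x,y,z)=\int_{\mathbb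 R^3}\frac{\rho(x',y',z')}{|(x,y,z)-(x',y',z')|}\,dx'dy'dz'$$ converges absolutely at every point of $\mathbb R^3$, and $f$ is quasi normal off the support of $\rho$, in the sense that for every closed bounded $W$ whose interior contains $\operatorname{Supp}(\rho)$ the restriction of $f$ to $\mathbb R^3\setminus W$ is quasi normal. 3. Let $\rho:\mathbb R^3\to\mathbb R$ be smooth with compact support, $\rho\ne0$. Then the same integral converges absolutely at every point and $f:\mathbb R^3\to\mathbb R$ is quasi split normal (with $W=\emptyset$). -/

import Mathlib

open scoped ContDiff

namespace Normality

noncomputable section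

/-- `ℝ^d` with the Euclidean norm. -/
abbrev Rn (d : ℕ) : Type := EuclideanSpace ℝ (Fin d)

/-- The real number `c` as a point of `ℝ^1`. -/
def pt (c : ℝ) : Rn 1 := WithLp.toLp 2 ![c]

/-- The point of `ℝ^(d+1)` whose `i`-th coordinate is `t` and whose remaining coordinates are,
in order, those of `q`. -/
def ins {d : ℕ} (i : Fin (d + 1)) (t : ℝ) (q : Rn d) : Rn (d + 1) :=
  WithLp.toLp 2 (i.insertNth t q.ofLp)

/-! A function `f : ℝ^d ∖ W → ℝ` is represented by a total function `f` together with the set `W`;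
every condition below only concerns the values of `f` off `W` (where `W` is closed, so that
derivatives at points off `W` only depend on these values too). -/

/-- `|f p| ≤ C / |p| ^ n` for all `p` in the domain with `|p| > 1`.  The case `n = 1` is
very moderate decrease, the case `n = 2` is moderate decrease. -/
def ModerateDecrease {d : ℕ} (n : ℕ) (W : Set (Rn d)) (f : Rn d → ℝ) : Prop :=
  ∃ C : ℝ, 0 < C ∧ ∀ p : Rn d, p ∉ W → 1 < ‖p‖ → |f p| ≤ C / ‖p‖ ^ n

/-- The partial derivative with respect to the `i`-th coordinate. -/
def pderiv {d : ℕ} (i : Fin d) (f : Rn d → ℝ) : Rn d → ℝ :=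
  fun p => lineDeriv ℝ f p (EuclideanSpace.single i (1 : ℝ))

/-- A smooth function `g : ℝ ∖ W → ℝ`, with `W` closed and bounded, is analytic at infinity: for
small `x > 0`, and for small `x < 0`, `g (1 / x)` is the sum of an (absolutely) convergent power
series `∑_{n ≥ 1} aₙ xⁿ`.  (`HasSum` in `ℝ` is unconditional, hence absolute, convergence.) -/
structure AnalyticAtInfinity (W : Set ℝ) (g : ℝ → ℝ) : Prop where
  isClosed : IsClosed W
  isBounded : Bornology.IsBounded W
  smooth : ContDiffOn ℝ ∞ g Wᶜ
  pos : ∃ ε : ℝ, 0 < ε ∧ ∃ a : ℕ → ℝ, ∀ x : ℝ, 0 < x → x < ε →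
    1 / x ∉ W ∧ HasSum (fun n : ℕ => a n * x ^ (n + 1)) (g (1 / x))
  neg : ∃ ε : ℝ, 0 < ε ∧ ∃ b : ℕ → ℝ, ∀ x : ℝ, -ε < x → x < 0 →
    1 / x ∉ W ∧ HasSum (fun n : ℕ => b n * x ^ (n + 1)) (g (1 / x))

/-- The zeros of the `k`-th derivative of `g : ℝ ∖ W → ℝ`. -/
def zeros (W : Set ℝ) (g : ℝ → ℝ) (k : ℕ) : Set ℝ :=
  {t | t ∉ W ∧ iteratedDeriv k g t = 0}

/-- The function of one variable obtained by letting the `i`-th coordinate vary and fixing the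
other ones to be those of `q`. -/
def line {d : ℕ} (i : Fin (d + 1)) (q : Rn d) (f : Rn (d + 1) → ℝ) : ℝ → ℝ :=
  fun t => f (ins i t q)

/-- The corresponding section of the excluded set. -/
def lineSet {d : ℕ} (i : Fin (d + 1)) (q : Rn d) (W : Set (Rn (d + 1))) : Set ℝ :=
  {t | ins i t q ∈ W}

/-- The function obtained by fixing the `i`-th coordinate to be `c`. -/
def slice {d : ℕ} (i : Fin (d + 1)) (c : ℝ) (f : Rn (d + 1) → ℝ) : Rn d → ℝ :=
  fun q => f (ins i c q)

/-- The corresponding section of the excluded set. -/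
def sliceSet {d : ℕ} (i : Fin (d + 1)) (c : ℝ) (W : Set (Rn (d + 1))) : Set (Rn d) :=
  {q | ins i c q ∈ W}

/-! ### Two variables -/

/-- The conditions common to the three notions of normality in two variables: `f` is smooth on
`ℝ² ∖ W` with `W` closed and bounded, all the functions `f_x` and `f_y` are analytic at infinity,
`f` is of very moderate decrease and its first partial derivatives are of moderate decrease.
In `line i (pt c) f` the `i`-th coordinate varies and the other one is fixed to be `c`. -/
structure Base2 (W : Set (Rn 2)) (f : Rn 2 → ℝ) : Prop where
  isClosed : IsClosed W
  isBounded : Bornology.IsBounded W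
  smooth : ContDiffOn ℝ ∞ f Wᶜ
  analytic : ∀ (i : Fin 2) (c : ℝ), AnalyticAtInfinity (lineSet i (pt c) W) (line i (pt c) f)
  decrease : ModerateDecrease 1 W f
  decrease_pderiv : ∀ i : Fin 2, ModerateDecrease 2 W (pderiv i f)

/-- `f : ℝ² ∖ W → ℝ` is normal: moreover the number of zeros of `f_x, f_x', f_x''` and of
`f_y, f_y', f_y''` is uniformly bounded. -/
structure Normal2 (W : Set (Rn 2)) (f : Rn 2 → ℝ) : Prop extends Base2 W f where
  zeros_le : ∃ val : ℕ, ∀ (i : Fin 2) (c : ℝ), ∀ k ≤ 2,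
    (zeros (lineSet i (pt c) W) (line i (pt c) f) k).encard ≤ val

/-- `f : ℝ² ∖ W → ℝ` is quasi normal: for sufficiently large `x`, the zeros of each of
`f_x, f_x', f_x''` are contained in a union `(-M, -N) ∪ (N, M)` with `M - N` bounded uniformly
in `x`, and similarly for `f_y, f_y', f_y''`. -/
structure QuasiNormal2 (W : Set (Rn 2)) (f : Rn 2 → ℝ) : Prop extends Base2 W f where
  zeros_subset : ∃ K R : ℝ, ∀ (i : Fin 2) (c : ℝ), K < |c| → ∀ k ≤ 2, ∃ M N : ℝ,
    N < M ∧ M - N ≤ R ∧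
      zeros (lineSet i (pt c) W) (line i (pt c) f) k ⊆ Set.Ioo (-M) (-N) ∪ Set.Ioo N M

/-- `f : ℝ² ∖ W → ℝ` is quasi split normal: off some larger closed bounded set, `f` is the sum of
two (smooth) quasi normal functions. -/
structure QuasiSplitNormal2 (W : Set (Rn 2)) (f : Rn 2 → ℝ) : Prop extends Base2 W f where
  split : ∃ (W' : Set (Rn 2)) (f₁ f₂ : Rn 2 → ℝ), W ⊆ W' ∧
    QuasiNormal2 W' f₁ ∧ QuasiNormal2 W' f₂ ∧ ∀ p ∉ W', f p = f₁ p + f₂ p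

/-! ### Three variables -/

/-- The conditions common to the three notions of normality in three variables: `f` is smooth on
`ℝ³ ∖ W` with `W` closed and bounded, `f` is of very moderate decrease, and each partial derivative
`∂^(i+j+k) f / ∂x^i ∂y^j ∂z^k` with `i + j + k ≥ 1` is of moderate decrease `i + j + k + 1`. -/
structure Base3 (W : Set (Rn 3)) (f : Rn 3 → ℝ) : Prop where
  isClosed : IsClosed W
  isBounded : Bornology.IsBounded W
  smooth : ContDiffOn ℝ ∞ f Wᶜ
  decrease : ModerateDecrease 1 W f
  decrease_pderiv : ∀ i j k : ℕ, 1 ≤ i + j + k →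
    ModerateDecrease (i + j + k + 1) W ((pderiv 0)^[i] ((pderiv 1)^[j] ((pderiv 2)^[k] f)))

/-- `f : ℝ³ ∖ W → ℝ` is normal. -/
structure Normal3 (W : Set (Rn 3)) (f : Rn 3 → ℝ) : Prop extends Base3 W f where
  slice_normal : ∀ (i : Fin 3) (c : ℝ), Normal2 (sliceSet i c W) (slice i c f)
  zeros_le : ∃ val : ℕ, ∀ (i : Fin 3) (q : Rn 2), ∀ k ≤ 4,
    (zeros (lineSet i q W) (line i q f) k).encard ≤ val

/-- For sufficiently large `(x, y)`, the zeros of `f_{x,y}` and of its first four derivatives are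
contained in a union of `S` bounded intervals of total length at most `R`, with `S` and `R`
independent of `(x, y)`; and similarly for `f_{x,z}` and `f_{y,z}`. -/
def ZerosInIntervals (W : Set (Rn 3)) (f : Rn 3 → ℝ) : Prop :=
  ∃ (K R : ℝ) (S : ℕ), ∀ (i : Fin 3) (q : Rn 2), K < ‖q‖ → ∃ a b : Fin S → ℝ,
    (∀ m, a m ≤ b m) ∧ ∑ m, (b m - a m) ≤ R ∧
      ∀ k ≤ 4, zeros (lineSet i q W) (line i q f) k ⊆ ⋃ m, Set.Icc (a m) (b m)

/-- `f : ℝ³ ∖ W → ℝ` is quasi normal. -/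
structure QuasiNormal3 (W : Set (Rn 3)) (f : Rn 3 → ℝ) : Prop extends Base3 W f where
  slice_quasiNormal : ∀ (i : Fin 3) (c : ℝ), QuasiNormal2 (sliceSet i c W) (slice i c f)
  zeros_subset : ZerosInIntervals W f

/-- `f : ℝ³ ∖ W → ℝ` is quasi split normal; the last condition says that off some larger closed
bounded set `f` is the sum of two smooth functions whose zeros lie in intervals as above. -/
structure QuasiSplitNormal3 (W : Set (Rn 3)) (f : Rn 3 → ℝ) : Prop extends Base3 W f where
  slice_quasiSplitNormal : ∀ (i : Fin 3) (c : ℝ),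
    QuasiSplitNormal2 (sliceSet i c W) (slice i c f)
  split : ∃ (W' : Set (Rn 3)) (f₁ f₂ : Rn 3 → ℝ), W ⊆ W' ∧ IsClosed W' ∧
    Bornology.IsBounded W' ∧ ContDiffOn ℝ ∞ f₁ W'ᶜ ∧ ContDiffOn ℝ ∞ f₂ W'ᶜ ∧
    ZerosInIntervals W' f₁ ∧ ZerosInIntervals W' f₂ ∧ ∀ p ∉ W', f p = f₁ p + f₂ p

/-- The Newtonian potential `∫ ρ(p') / |p - p'| dp'` of a density on `ℝ³`. -/
def potential (ρ : Rn 3 → ℝ) : Rn 3 → ℝ :=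
  fun p => ∫ p' : Rn 3, ρ p' / ‖p - p'‖

end

end Normality

namespace Normality

open MeasureTheory

noncomputable section

section Parametric

variable {X : Type*} [TopologicalSpace X] [T2Space X] [SecondCountableTopology X]
  [MeasurableSpace X] [OpensMeasurableSpace X] {𝕜 : Type*} [RCLike 𝕜]
  {E : Type*} [NormedAddCommGroup E] [NormedSpace 𝕜 E]

/-- A density times a function that is continuous on the compact set carrying the measure is
integrable. -/
theorem integrable_smul_of_continuousOn {ν : Measure X} {S : Set X} (hS : IsCompact S)
    (hν : ∀ᵐ a ∂ν, a ∈ S) {ρ : X → 𝕜} (hρ : Integrable ρ ν) {φ : X → E}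
    (hφ : ContinuousOn φ S) : Integrable (fun a => ρ a • φ a) ν := by
  have hm : AEStronglyMeasurable φ ν := by
    rw [← Measure.restrict_eq_self_of_ae_mem hν]
    exact hφ.aestronglyMeasurable hS.measurableSet
  obtain ⟨B, hB⟩ := hS.exists_bound_of_continuousOn hφ
  refine Integrable.mono' (hρ.norm.mul_const B) (hρ.aestronglyMeasurable.smul hm) ?_
  filter_upwards [hν] with a ha
  rw [norm_smul]
  exact mul_le_mul_of_nonneg_left (hB a ha) (norm_nonneg _)

theorem hasFDerivAt_integral_smul_of_continuousOn {H : Type*} [NormedAddCommGroup H]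
    [NormedSpace 𝕜 H] [LocallyCompactSpace H] [NormedSpace ℝ E] {ν : Measure X} {S : Set X} (hS : IsCompact S)
    (hν : ∀ᵐ a ∂ν, a ∈ S) {ρ : X → 𝕜} (hρ : Integrable ρ ν) {U : Set H} (hU : IsOpen U)
    {Φ : H → X → E} {Φ' : H → X → H →L[𝕜] E}
    (hΦ : ∀ x ∈ U, ContinuousOn (Φ x) S)
    (hΦ' : ContinuousOn (fun z : H × X => Φ' z.1 z.2) (U ×ˢ S))
    (hd : ∀ x ∈ U, ∀ a ∈ S, HasFDerivAt (fun y => Φ y a) (Φ' x a) x) {x₀ : H} (hx₀ : x₀ ∈ U) :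
    HasFDerivAt (fun x => ∫ a, ρ a • Φ x a ∂ν) (∫ a, ρ a • Φ' x₀ a ∂ν) x₀ := by
  obtain ⟨K, hK, hKU, hKc⟩ := local_compact_nhds (hU.mem_nhds hx₀)
  obtain ⟨B, hB⟩ := (hKc.prod hS).exists_bound_of_continuousOn
    (hΦ'.mono (Set.prod_mono hKU subset_rfl))
  have hΦ'₀ : ContinuousOn (Φ' x₀) S :=
    hΦ'.comp (f := fun a => (x₀, a)) (by fun_prop) (fun a ha => ⟨hx₀, ha⟩)
  refine hasFDerivAt_integral_of_dominated_of_fderiv_le (bound := fun a => ‖ρ a‖ * B)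
    (F' := fun x a => ρ a • Φ' x a) hK ?_ ?_ ?_ ?_ ?_ ?_
  · filter_upwards [hK] with x hx
    exact (integrable_smul_of_continuousOn hS hν hρ (hΦ x (hKU hx))).aestronglyMeasurable
  · exact integrable_smul_of_continuousOn hS hν hρ (hΦ x₀ hx₀)
  · exact (integrable_smul_of_continuousOn hS hν hρ hΦ'₀).aestronglyMeasurable
  · filter_upwards [hν] with a ha x hx
    rw [norm_smul]
    exact mul_le_mul_of_nonneg_left (hB (x, a) ⟨hx, ha⟩) (norm_nonneg _)
  · exact hρ.norm.mul_const B
  · filter_upwards [hν] with a ha x hx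
    exact (hd x (hKU hx) a ha).const_smul (ρ a)

end Parametric

/-! ### Potentials of densities carried by a compact set -/

/-- `ρ` is a density for the measure `ν`, which is carried by the compact set `S`. -/
structure IsSource (ν : Measure (Rn 3)) (S : Set (Rn 3)) (ρ : Rn 3 → ℝ) : Prop where
  isCompact : IsCompact S
  ae_mem : ∀ᵐ a ∂ν, a ∈ S
  integrable : Integrable ρ ν

/-- The potential with kernel `φ` of the density `ρ`. -/
def layer {E : Type*} [NormedAddCommGroup E] [NormedSpace ℝ E] (ν : Measure (Rn 3))
    (ρ : Rn 3 → ℝ) (φ : Rn 3 → E) : Rn 3 → E :=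
  fun p => ∫ a, ρ a • φ (p - a) ∂ν

section Layer

variable {E : Type*} [NormedAddCommGroup E] [NormedSpace ℝ E]
  {ν : Measure (Rn 3)} {S : Set (Rn 3)} {ρ : Rn 3 → ℝ} {φ : Rn 3 → E}

theorem sub_ne_zero_of_notMem {p a : Rn 3} (hp : p ∉ S) (ha : a ∈ S) :
    p - a ∈ ({0}ᶜ : Set (Rn 3)) :=
  fun h => hp (by rwa [sub_eq_zero.1 h])

theorem continuousOn_comp_const_sub {E : Type*} [TopologicalSpace E] {φ : Rn 3 → E} (hφ : ContinuousOn φ {0}ᶜ) {p : Rn 3} (hp : p ∉ S) :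
    ContinuousOn (fun a => φ (p - a)) S :=
  hφ.comp (by fun_prop) (fun _ ha => sub_ne_zero_of_notMem hp ha)

theorem IsSource.integrable_layer (h : IsSource ν S ρ) (hφ : ContinuousOn φ {0}ᶜ) {p : Rn 3}
    (hp : p ∉ S) : Integrable (fun a => ρ a • φ (p - a)) ν :=
  integrable_smul_of_continuousOn h.isCompact h.ae_mem h.integrable
    (continuousOn_comp_const_sub hφ hp)

theorem contDiffOn_fderiv_compl_zero (hφ : ContDiffOn ℝ ∞ φ {0}ᶜ) :
    ContDiffOn ℝ ∞ (fderiv ℝ φ) {0}ᶜ :=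
  ((contDiffOn_infty_iff_fderiv_of_isOpen isOpen_compl_singleton).1 hφ).2

theorem IsSource.hasFDerivAt_layer (h : IsSource ν S ρ) (hφ : ContDiffOn ℝ ∞ φ {0}ᶜ) {p : Rn 3}
    (hp : p ∉ S) : HasFDerivAt (layer ν ρ φ) (layer ν ρ (fderiv ℝ φ) p) p := by
  refine hasFDerivAt_integral_smul_of_continuousOn (𝕜 := ℝ) h.isCompact h.ae_mem h.integrable
    h.isCompact.isClosed.isOpen_compl (Φ := fun p a => φ (p - a))
    (Φ' := fun p a => fderiv ℝ φ (p - a)) ?_ ?_ ?_ hp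
  · exact fun x hx => continuousOn_comp_const_sub hφ.continuousOn hx
  · exact (contDiffOn_fderiv_compl_zero hφ).continuousOn.comp
      (f := fun z : Rn 3 × Rn 3 => z.1 - z.2) (by fun_prop)
      (fun z hz => sub_ne_zero_of_notMem hz.1 hz.2)
  · intro x hx a ha
    have hd : DifferentiableAt ℝ φ (x - a) :=
      (hφ.differentiableOn (by simp)).differentiableAt
        (isOpen_compl_singleton.mem_nhds (sub_ne_zero_of_notMem hx ha))
    simpa [Function.comp_def] using hd.hasFDerivAt.comp x ((hasFDerivAt_id x).sub_const a)

theorem IsSource.contDiffOn_layer (h : IsSource ν S ρ) (hφ : ContDiffOn ℝ ∞ φ {0}ᶜ) :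
    ContDiffOn ℝ ∞ (layer ν ρ φ) Sᶜ := by
  refine contDiffOn_infty.2 fun n => ?_
  induction n generalizing E with
  | zero =>
    exact contDiffOn_zero.2 fun p hp => (h.hasFDerivAt_layer hφ hp).continuousAt.continuousWithinAt
  | succ n ih =>
    have hS := h.isCompact.isClosed.isOpen_compl
    push_cast
    refine (contDiffOn_succ_iff_fderiv_of_isOpen hS).2
      ⟨fun p hp => (h.hasFDerivAt_layer hφ hp).differentiableAt.differentiableWithinAt,
        by simp, ?_⟩
    exact (ih (contDiffOn_fderiv_compl_zero hφ)).congr fun p hp =>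
      (h.hasFDerivAt_layer hφ hp).fderiv

end Layer

/-! ### Partial derivatives -/

theorem pderiv_eq_fderiv {d : ℕ} {f : Rn d → ℝ} {p : Rn d} (hf : DifferentiableAt ℝ f p)
    (i : Fin d) : pderiv i f p = fderiv ℝ f p (EuclideanSpace.single i 1) :=
  hf.lineDeriv_eq_fderiv

theorem contDiffOn_pderiv {d : ℕ} {f : Rn d → ℝ} {U : Set (Rn d)} (hU : IsOpen U)
    (hf : ContDiffOn ℝ ∞ f U) (i : Fin d) : ContDiffOn ℝ ∞ (pderiv i f) U := by
  have h := (contDiffOn_infty_iff_fderiv_of_isOpen hU).1 hf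
  exact (h.2.clm_apply contDiffOn_const).congr fun p hp =>
    pderiv_eq_fderiv (h.1.differentiableAt (hU.mem_nhds hp)) i

theorem contDiffOn_pderiv_iterate {d : ℕ} {f : Rn d → ℝ} {U : Set (Rn d)} (hU : IsOpen U)
    (hf : ContDiffOn ℝ ∞ f U) (i : Fin d) (n : ℕ) :
    ContDiffOn ℝ ∞ ((pderiv i)^[n] f) U := by
  induction n with
  | zero => exact hf
  | succ n ih =>
    rw [Function.iterate_succ_apply']
    exact contDiffOn_pderiv hU ih i

theorem pderiv_congr {d : ℕ} {f g : Rn d → ℝ} {U : Set (Rn d)} (hU : IsOpen U)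
    (hfg : Set.EqOn f g U) (i : Fin d) : Set.EqOn (pderiv i f) (pderiv i g) U := fun _ hp =>
  (hfg.eventuallyEq_of_mem (hU.mem_nhds hp)).lineDeriv_eq

section Layer

variable {ν : Measure (Rn 3)} {S : Set (Rn 3)} {ρ : Rn 3 → ℝ} {φ : Rn 3 → ℝ}

theorem IsSource.pderiv_layer (h : IsSource ν S ρ) (hφ : ContDiffOn ℝ ∞ φ {0}ᶜ) (i : Fin 3) :
    Set.EqOn (pderiv i (layer ν ρ φ)) (layer ν ρ (pderiv i φ)) Sᶜ := by
  intro p hp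
  have hd := h.hasFDerivAt_layer hφ hp
  rw [pderiv_eq_fderiv hd.differentiableAt, hd.fderiv, layer, ContinuousLinearMap.integral_apply
    (h.integrable_layer (contDiffOn_fderiv_compl_zero hφ).continuousOn hp)]
  refine integral_congr_ae ?_
  filter_upwards [h.ae_mem] with a ha
  rw [pderiv_eq_fderiv ((hφ.differentiableOn (by simp)).differentiableAt
        (isOpen_compl_singleton.mem_nhds (sub_ne_zero_of_notMem hp ha)))]
  rfl

theorem IsSource.pderiv_iterate_layer (h : IsSource ν S ρ) (hφ : ContDiffOn ℝ ∞ φ {0}ᶜ)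
    {F : Rn 3 → ℝ} (hF : Set.EqOn F (layer ν ρ φ) Sᶜ) (i : Fin 3) (n : ℕ) :
    Set.EqOn ((pderiv i)^[n] F) (layer ν ρ ((pderiv i)^[n] φ)) Sᶜ := by
  induction n with
  | zero => exact hF
  | succ n ih =>
    rw [Function.iterate_succ_apply', Function.iterate_succ_apply']
    exact (pderiv_congr h.isCompact.isClosed.isOpen_compl ih i).trans
      (h.pderiv_layer (contDiffOn_pderiv_iterate isOpen_compl_singleton hφ i n) i)

end Layer

/-! ### Homogeneous kernels and decay -/

/-- `φ` is positively homogeneous of degree `-m`. -/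
def IsHomogeneousNeg {d : ℕ} (m : ℕ) (φ : Rn d → ℝ) : Prop :=
  ∀ s : ℝ, 0 < s → ∀ v : Rn d, φ (s • v) = (s ^ m)⁻¹ * φ v

theorem IsHomogeneousNeg.pderiv {d m : ℕ} {φ : Rn d → ℝ} (hφ : IsHomogeneousNeg m φ)
    (i : Fin d) : IsHomogeneousNeg (m + 1) (pderiv i φ) := by
  intro s hs v
  have h : (fun t : ℝ => φ (s • v + t • EuclideanSpace.single i (1 : ℝ))) =
      fun t => (s ^ m)⁻¹ * φ (v + (s⁻¹ * t) • EuclideanSpace.single i (1 : ℝ)) := by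
    funext t
    rw [← hφ s hs, smul_add, smul_smul, mul_inv_cancel_left₀ hs.ne']
  simp only [Normality.pderiv, lineDeriv]
  rw [h, deriv_const_mul_field, deriv_comp_mul_left s⁻¹
    (fun t => φ (v + t • EuclideanSpace.single i (1 : ℝ))) 0]
  simp only [mul_zero, smul_eq_mul, pow_succ, mul_inv, mul_assoc]

theorem IsHomogeneousNeg.pderiv_iterate {d m : ℕ} {φ : Rn d → ℝ} (hφ : IsHomogeneousNeg m φ)
    (i : Fin d) (n : ℕ) : IsHomogeneousNeg (m + n) ((Normality.pderiv i)^[n] φ) := by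
  induction n with
  | zero => exact hφ
  | succ n ih =>
    rw [Function.iterate_succ_apply']
    exact ih.pderiv i

theorem IsHomogeneousNeg.exists_bound {d m : ℕ} {φ : Rn d → ℝ} (hφ : IsHomogeneousNeg m φ)
    (hc : ContinuousOn φ {0}ᶜ) : ∃ C : ℝ, 0 ≤ C ∧ ∀ v ≠ 0, |φ v| ≤ C / ‖v‖ ^ m := by
  obtain ⟨C, hC⟩ := (isCompact_sphere (0 : Rn d) 1).exists_bound_of_continuousOn
    (hc.mono fun v hv => by
      rintro rfl
      simp at hv)
  refine ⟨max C 0, le_max_right _ _, fun v hv => ?_⟩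
  have hv' : 0 < ‖v‖ := norm_pos_iff.2 hv
  have h1 : ‖φ (‖v‖⁻¹ • v)‖ ≤ C := hC _ (by
    rw [mem_sphere_zero_iff_norm, norm_smul, norm_inv, norm_norm, inv_mul_cancel₀ hv'.ne'])
  have h2 : v = ‖v‖ • (‖v‖⁻¹ • v) := by rw [smul_smul, mul_inv_cancel₀ hv'.ne', one_smul]
  calc |φ v| = (‖v‖ ^ m)⁻¹ * ‖φ (‖v‖⁻¹ • v)‖ := by
        conv_lhs => rw [h2, hφ _ hv']
        rw [abs_mul, Real.norm_eq_abs, abs_of_pos (by positivity : 0 < (‖v‖ ^ m)⁻¹)]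
    _ ≤ (‖v‖ ^ m)⁻¹ * max C 0 := by
        gcongr
        exact h1.trans (le_max_left _ _)
    _ = max C 0 / ‖v‖ ^ m := by rw [div_eq_mul_inv, mul_comm]

theorem exists_norm_le_mul_norm_sub {S W : Set (Rn 3)} (hS : IsCompact S)
    (hW : S ⊆ interior W) : ∃ A : ℝ, 0 < A ∧ ∀ p ∉ W, ∀ a ∈ S, ‖p‖ ≤ A * ‖p - a‖ := by
  obtain ⟨δ, hδ, hδW⟩ := hS.exists_cthickening_subset_open isOpen_interior hW
  obtain ⟨r, hr⟩ := hS.isBounded.exists_norm_le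
  refine ⟨1 + |r| / δ, by positivity, fun p hp a ha => ?_⟩
  have h1 : δ ≤ ‖p - a‖ := by
    by_contra! h
    refine hp (interior_subset (hδW (Metric.mem_cthickening_of_dist_le p a δ S ha ?_)))
    rw [dist_eq_norm]
    exact h.le
  have h2 : ‖p‖ ≤ ‖p - a‖ + |r| := by
    calc ‖p‖ = ‖(p - a) + a‖ := by rw [sub_add_cancel]
      _ ≤ ‖p - a‖ + ‖a‖ := norm_add_le _ _
      _ ≤ _ := by gcongr; exact (hr a ha).trans (le_abs_self r)
  have h3 : |r| ≤ |r| / δ * ‖p - a‖ := by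
    rw [div_mul_eq_mul_div, le_div_iff₀ hδ]
    gcongr
  linarith

theorem IsSource.moderateDecrease_layer {ν : Measure (Rn 3)} {S W : Set (Rn 3)} {ρ φ F : Rn 3 → ℝ}
    (h : IsSource ν S ρ) (hW : S ⊆ interior W) {m : ℕ} (hφ : IsHomogeneousNeg m φ)
    (hc : ContinuousOn φ {0}ᶜ) (hF : Set.EqOn F (layer ν ρ φ) Sᶜ) : ModerateDecrease m W F := by
  obtain ⟨A, hA, hAW⟩ := exists_norm_le_mul_norm_sub h.isCompact hW
  obtain ⟨C, hC, hCφ⟩ := hφ.exists_bound hc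
  have hI : 0 ≤ ∫ a, ‖ρ a‖ ∂ν := integral_nonneg fun _ => norm_nonneg _
  refine ⟨(∫ a, ‖ρ a‖ ∂ν) * (C * A ^ m) + 1, by positivity, fun p hp hp1 => ?_⟩
  have hpS : p ∉ S := fun hs => hp (interior_subset (hW hs))
  have hp0 : 0 < ‖p‖ := by linarith
  have h1 : ‖layer ν ρ φ p‖ ≤ ∫ a, ‖ρ a‖ * (C * A ^ m / ‖p‖ ^ m) ∂ν := by
    refine norm_integral_le_of_norm_le (h.integrable.norm.mul_const _) ?_
    filter_upwards [h.ae_mem] with a ha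
    rw [norm_smul]
    refine mul_le_mul_of_nonneg_left ?_ (norm_nonneg _)
    have hpa : p - a ≠ 0 := sub_ne_zero_of_notMem hpS ha
    have hpa' : 0 < ‖p - a‖ := norm_pos_iff.2 hpa
    refine (hCφ _ hpa).trans ?_
    rw [div_le_div_iff₀ (by positivity) (by positivity), mul_assoc, ← mul_pow]
    gcongr
    exact hAW p hp a ha
  rw [integral_mul_const, Real.norm_eq_abs] at h1
  rw [hF hpS]
  refine h1.trans ?_
  rw [← mul_div_assoc]
  gcongr
  linarith

/-! ### The Newtonian kernel -/

/-- The Newtonian kernel `1 / |v|`. -/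
def kernel : Rn 3 → ℝ := fun v => ‖v‖⁻¹

theorem contDiffOn_kernel : ContDiffOn ℝ ∞ kernel {0}ᶜ := fun _ hv =>
  ((contDiffAt_norm ℝ hv).inv (norm_ne_zero_iff.2 hv)).contDiffWithinAt

theorem isHomogeneousNeg_kernel : IsHomogeneousNeg 1 kernel := by
  intro s hs v
  simp only [kernel, norm_smul, Real.norm_of_nonneg hs.le, mul_inv, pow_one]

theorem IsSource.base3 {ν : Measure (Rn 3)} {S W : Set (Rn 3)} {ρ F : Rn 3 → ℝ}
    (h : IsSource ν S ρ) (hWc : IsClosed W) (hWb : Bornology.IsBounded W) (hW : S ⊆ interior W)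
    (hF : Set.EqOn F (layer ν ρ kernel) Sᶜ) : Base3 W F := by
  refine ⟨hWc, hWb, ?_, ?_, fun i j k _ => ?_⟩
  · exact ((h.contDiffOn_layer contDiffOn_kernel).congr hF).mono
      (Set.compl_subset_compl.2 (hW.trans interior_subset))
  · exact h.moderateDecrease_layer hW isHomogeneousNeg_kernel contDiffOn_kernel.continuousOn hF
  · have h2 := contDiffOn_pderiv_iterate isOpen_compl_singleton contDiffOn_kernel 2 k
    have h1 := contDiffOn_pderiv_iterate isOpen_compl_singleton h2 1 j
    have h0 := contDiffOn_pderiv_iterate isOpen_compl_singleton h1 0 i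
    have hm := ((isHomogeneousNeg_kernel.pderiv_iterate 2 k).pderiv_iterate 1 j).pderiv_iterate 0 i
    rw [show 1 + k + j + i = i + j + k + 1 by ring] at hm
    exact h.moderateDecrease_layer hW hm h0.continuousOn (h.pderiv_iterate_layer h1
      (h.pderiv_iterate_layer h2 (h.pderiv_iterate_layer contDiffOn_kernel hF 2 k) 1 j) 0 i)

/-! ### Inserting a coordinate -/

section Ins

variable {d : ℕ}

@[simp]
theorem ins_apply_same (i : Fin (d + 1)) (t : ℝ) (q : Rn d) : ins i t q i = t := by
  simp [ins]

@[simp]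
theorem ins_apply_succAbove (i : Fin (d + 1)) (t : ℝ) (q : Rn d) (j : Fin d) :
    ins i t q (i.succAbove j) = q j := by
  simp [ins]

theorem ext_succAbove (i : Fin (d + 1)) {p p' : Rn (d + 1)} (hi : p i = p' i)
    (hj : ∀ j : Fin d, p (i.succAbove j) = p' (i.succAbove j)) : p = p' := by
  ext l
  rcases Fin.eq_self_or_eq_succAbove i l with rfl | ⟨j, rfl⟩
  exacts [hi, hj j]

theorem exists_eq_ins (i : Fin (d + 1)) (p : Rn (d + 1)) : ∃ q : Rn d, p = ins i (p i) q :=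
  ⟨WithLp.toLp 2 fun j => p (i.succAbove j), ext_succAbove i (by simp) (by simp)⟩

theorem ins_sub_ins (i : Fin (d + 1)) (t s : ℝ) (q r : Rn d) :
    ins i t q - ins i s r = ins i (t - s) (q - r) :=
  ext_succAbove i (by simp) (by simp)

theorem ins_add_smul_single (i : Fin (d + 1)) (t s : ℝ) (q : Rn d) :
    ins i t q + s • EuclideanSpace.single i (1 : ℝ) = ins i (t + s) q :=
  ext_succAbove i (by simp) (by simp)

theorem ins_add_smul_single_succAbove (i : Fin (d + 1)) (t s : ℝ) (q : Rn d) (j : Fin d) :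
    ins i t q + s • EuclideanSpace.single (i.succAbove j) (1 : ℝ) =
      ins i t (q + s • EuclideanSpace.single j (1 : ℝ)) :=
  ext_succAbove i (by simp [Fin.ne_succAbove])
    (by simp)

theorem norm_ins_sq (i : Fin (d + 1)) (t : ℝ) (q : Rn d) :
    ‖ins i t q‖ ^ 2 = t ^ 2 + ‖q‖ ^ 2 := by
  simp [EuclideanSpace.norm_sq_eq, Fin.sum_univ_succAbove _ i]

theorem norm_pt_sq (c : ℝ) : ‖pt c‖ ^ 2 = c ^ 2 := by
  simp [EuclideanSpace.norm_sq_eq, pt]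

theorem norm_le_norm_ins (i : Fin (d + 1)) (t : ℝ) (q : Rn d) : ‖q‖ ≤ ‖ins i t q‖ := by
  refine le_of_sq_le_sq ?_ (norm_nonneg _)
  rw [norm_ins_sq]
  nlinarith [sq_nonneg t]

theorem abs_le_norm_ins (i : Fin (d + 1)) (t : ℝ) (q : Rn d) : |t| ≤ ‖ins i t q‖ := by
  refine abs_le_of_sq_le_sq' ?_ (norm_nonneg _) |> abs_le.2
  rw [norm_ins_sq]
  nlinarith [sq_nonneg ‖q‖]

theorem contDiff_ins (i : Fin (d + 1)) (q : Rn d) : ContDiff ℝ ∞ fun t => ins i t q := by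
  rw [contDiff_euclidean]
  intro l
  rcases Fin.eq_self_or_eq_succAbove i l with rfl | ⟨j, rfl⟩
  · simp only [ins_apply_same]
    fun_prop
  · simpa using contDiff_const

theorem contDiff_ins_right (i : Fin (d + 1)) (t : ℝ) : ContDiff ℝ ∞ (ins (d := d) i t) := by
  rw [contDiff_euclidean]
  intro l
  rcases Fin.eq_self_or_eq_succAbove i l with rfl | ⟨j, rfl⟩
  · simpa using contDiff_const
  · simp only [ins_apply_succAbove]
    fun_prop

/-! ### Lines and slices -/

theorem iteratedDeriv_line (i : Fin (d + 1)) (q : Rn d) (f : Rn (d + 1) → ℝ) (k : ℕ) :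
    iteratedDeriv k (line i q f) = line i q ((pderiv i)^[k] f) := by
  induction k with
  | zero => rw [iteratedDeriv_zero, Function.iterate_zero_apply]
  | succ k ih =>
    rw [iteratedDeriv_succ, ih, Function.iterate_succ_apply']
    funext t
    have h := deriv_comp_const_add (line i q ((pderiv i)^[k] f)) t 0
    rw [add_zero] at h
    rw [← h]
    simp only [line, pderiv, lineDeriv, ins_add_smul_single]

theorem pderiv_slice (i : Fin (d + 1)) (c : ℝ) (f : Rn (d + 1) → ℝ) (j : Fin d) :
    pderiv j (slice i c f) = slice i c (pderiv (i.succAbove j) f) := by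
  funext q
  simp only [pderiv, slice, lineDeriv, ins_add_smul_single_succAbove]

theorem isClosed_lineSet (i : Fin (d + 1)) (q : Rn d) {W : Set (Rn (d + 1))} (hW : IsClosed W) :
    IsClosed (lineSet i q W) :=
  hW.preimage (contDiff_ins i q).continuous

theorem isClosed_sliceSet (i : Fin (d + 1)) (c : ℝ) {W : Set (Rn (d + 1))} (hW : IsClosed W) :
    IsClosed (sliceSet i c W) :=
  hW.preimage (contDiff_ins_right i c).continuous

theorem isBounded_lineSet (i : Fin (d + 1)) (q : Rn d) {W : Set (Rn (d + 1))}
    (hW : Bornology.IsBounded W) : Bornology.IsBounded (lineSet i q W) := by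
  obtain ⟨C, hC⟩ := hW.exists_norm_le
  exact isBounded_iff_forall_norm_le.2 ⟨C, fun t ht => (abs_le_norm_ins i t q).trans (hC _ ht)⟩

theorem isBounded_sliceSet (i : Fin (d + 1)) (c : ℝ) {W : Set (Rn (d + 1))}
    (hW : Bornology.IsBounded W) : Bornology.IsBounded (sliceSet i c W) := by
  obtain ⟨C, hC⟩ := hW.exists_norm_le
  exact isBounded_iff_forall_norm_le.2 ⟨C, fun q hq => (norm_le_norm_ins i c q).trans (hC _ hq)⟩

theorem contDiffOn_line (i : Fin (d + 1)) (q : Rn d) {W : Set (Rn (d + 1))} {f : Rn (d + 1) → ℝ}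
    (hf : ContDiffOn ℝ ∞ f Wᶜ) : ContDiffOn ℝ ∞ (line i q f) (lineSet i q W)ᶜ :=
  hf.comp (contDiff_ins i q).contDiffOn fun _ ht => ht

theorem contDiffOn_slice (i : Fin (d + 1)) (c : ℝ) {W : Set (Rn (d + 1))} {f : Rn (d + 1) → ℝ}
    (hf : ContDiffOn ℝ ∞ f Wᶜ) : ContDiffOn ℝ ∞ (slice i c f) (sliceSet i c W)ᶜ :=
  hf.comp (contDiff_ins_right i c).contDiffOn fun _ ht => ht

theorem ModerateDecrease.slice {n : ℕ} {W : Set (Rn (d + 1))} {f : Rn (d + 1) → ℝ}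
    (h : ModerateDecrease n W f) (i : Fin (d + 1)) (c : ℝ) :
    ModerateDecrease n (sliceSet i c W) (slice i c f) := by
  obtain ⟨C, hC, h⟩ := h
  refine ⟨C, hC, fun q hq hq1 => ?_⟩
  have hle := norm_le_norm_ins i c q
  have h0 : 0 < ‖q‖ := by linarith
  refine (h _ hq (hq1.trans_le hle)).trans ?_
  gcongr

end Ins

theorem exists_ins_ins_eq (i : Fin 3) (j : Fin 2) (c e : ℝ) : ∃ q : Rn 2,
    ‖q‖ ^ 2 = c ^ 2 + e ^ 2 ∧ ∀ t, ins i c (ins j t (pt e)) = ins (i.succAbove j) t q := by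
  obtain ⟨q, hq⟩ := exists_eq_ins (i.succAbove j) (ins i c (ins j 0 (pt e)))
  rw [ins_apply_succAbove, ins_apply_same] at hq
  refine ⟨q, ?_, fun t => ?_⟩
  · have := congrArg (‖·‖ ^ 2) hq
    simpa [norm_ins_sq, norm_pt_sq] using this.symm
  · have := congrArg (· + t • EuclideanSpace.single (i.succAbove j) (1 : ℝ)) hq
    simpa only [ins_add_smul_single_succAbove, ins_add_smul_single, zero_add] using this

/-- A line in a slice is a line. -/
theorem exists_line_slice (i : Fin 3) (j : Fin 2) (c e : ℝ) : ∃ q : Rn 2,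
    ‖q‖ ^ 2 = c ^ 2 + e ^ 2 ∧
    (∀ f, line j (pt e) (slice i c f) = line (i.succAbove j) q f) ∧
    ∀ W, lineSet j (pt e) (sliceSet i c W) = lineSet (i.succAbove j) q W := by
  obtain ⟨q, hn, hq⟩ := exists_ins_ins_eq i j c e
  exact ⟨q, hn, fun f => funext fun t => congrArg f (hq t),
    fun W => Set.ext fun t => (congrArg (· ∈ W) (hq t)).to_iff⟩

theorem Base3.moderateDecrease_pderiv {W : Set (Rn 3)} {f : Rn 3 → ℝ} (h : Base3 W f)
    (i : Fin 3) : ModerateDecrease 2 W (pderiv i f) := by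
  fin_cases i
  · exact h.decrease_pderiv 1 0 0 le_rfl
  · exact h.decrease_pderiv 0 1 0 le_rfl
  · exact h.decrease_pderiv 0 0 1 le_rfl

theorem Base3.base2_slice {W : Set (Rn 3)} {f : Rn 3 → ℝ} (h : Base3 W f)
    (ha : ∀ (i : Fin 3) (q : Rn 2), AnalyticAtInfinity (lineSet i q W) (line i q f))
    (i : Fin 3) (c : ℝ) : Base2 (sliceSet i c W) (slice i c f) where
  isClosed := isClosed_sliceSet i c h.isClosed
  isBounded := isBounded_sliceSet i c h.isBounded
  smooth := contDiffOn_slice i c h.smooth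
  analytic j e := by
    obtain ⟨q, -, h1, h2⟩ := exists_line_slice i j c e
    rw [h1, h2]
    exact ha _ q
  decrease := h.decrease.slice i c
  decrease_pderiv j := by
    rw [pderiv_slice]
    exact (h.moderateDecrease_pderiv _).slice i c

/-! ### Expansion at infinity -/

theorem norm_add_inv_smul {e v : Rn 3} {x : ℝ} (hx : x ≠ 0) :
    ‖v + x⁻¹ • e‖⁻¹ = |x| * ‖e + x • v‖⁻¹ := by
  have h : v + x⁻¹ • e = x⁻¹ • (e + x • v) := by
    rw [smul_add, smul_smul, inv_mul_cancel₀ hx, one_smul, add_comm]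
  rw [h, norm_smul, mul_inv, norm_inv, inv_inv, Real.norm_eq_abs]

theorem ofReal_inv_norm_add_smul {e : Rn 3} (he : ‖e‖ = 1) (v : Rn 3) (x : ℝ) :
    ((‖e + x • v‖⁻¹ : ℝ) : ℂ) =
      (1 + (2 * inner ℝ e v * x + ‖v‖ ^ 2 * x ^ 2) : ℂ) ^ (-(1 / 2) : ℂ) := by
  have h : ‖e + x • v‖ ^ 2 = 1 + (2 * inner ℝ e v * x + ‖v‖ ^ 2 * x ^ 2) := by
    rw [norm_add_sq_real, he, inner_smul_right, norm_smul, mul_pow, Real.norm_eq_abs, sq_abs]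
    ring
  have h' : ‖e + x • v‖⁻¹ = (‖e + x • v‖ ^ 2) ^ (-(1 / 2) : ℝ) := by
    rw [← Real.rpow_natCast, ← Real.rpow_mul (norm_nonneg _), ← Real.rpow_neg_one]
    norm_num
  rw [h', Complex.ofReal_cpow (sq_nonneg _), h]
  push_cast
  rfl

theorem IsSource.exists_hasSum {ν : Measure (Rn 3)} {S : Set (Rn 3)} {ρ : Rn 3 → ℝ}
    (h : IsSource ν S ρ) (p e : Rn 3) (he : ‖e‖ = 1) : ∃ ε : ℝ, 0 < ε ∧ ∃ a : ℕ → ℝ,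
      ∀ x : ℝ, |x| < ε → HasSum (fun n => a n * x ^ n) (∫ b, ρ b * ‖e + x • (p - b)‖⁻¹ ∂ν) := by
  obtain ⟨B₀, hB₀⟩ := (h.isCompact.image (continuous_const.sub continuous_id :
    Continuous fun b => p - b)).isBounded.exists_norm_le
  obtain ⟨B, hB1, hB⟩ : ∃ B : ℝ, 1 ≤ B ∧ ∀ b ∈ S, ‖p - b‖ ≤ B :=
    ⟨max 1 B₀, le_max_left _ _, fun b hb => (hB₀ _ ⟨b, hb, rfl⟩).trans (le_max_right _ _)⟩
  let w : ℂ → Rn 3 → ℂ := fun z b => 2 * inner ℝ e (p - b) * z + ‖p - b‖ ^ 2 * z ^ 2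
  have hw : ∀ z ∈ Metric.ball (0 : ℂ) (1 / (4 * B)), ∀ b ∈ S, 1 + w z b ∈ Complex.slitPlane := by
    intro z hz b hb
    apply Complex.mem_slitPlane_of_norm_lt_one
    have hz' : ‖z‖ * B < 1 / 4 := by
      rw [mem_ball_zero_iff, lt_div_iff₀ (by positivity)] at hz
      linarith
    have hi : |inner ℝ e (p - b)| ≤ B := by
      have := abs_real_inner_le_norm e (p - b)
      rw [he, one_mul] at this
      exact this.trans (hB b hb)
    have h1 : ‖(2 * inner ℝ e (p - b) * z : ℂ)‖ ≤ 2 * (‖z‖ * B) := by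
      simp only [norm_mul, Complex.norm_ofNat, Complex.norm_real, Real.norm_eq_abs]
      nlinarith [norm_nonneg z]
    have h2 : ‖(‖p - b‖ ^ 2 * z ^ 2 : ℂ)‖ ≤ (‖z‖ * B) ^ 2 := by
      simp only [norm_mul, norm_pow, Complex.norm_real, norm_norm]
      rw [← mul_pow, mul_comm]
      gcongr
      exact hB b hb
    have h3 : 0 ≤ ‖z‖ * B := by positivity
    calc ‖w z b‖ ≤ 2 * (‖z‖ * B) + (‖z‖ * B) ^ 2 := (norm_add_le _ _).trans (add_le_add h1 h2)
      _ < 1 := by nlinarith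
  let w' : ℂ → Rn 3 → ℂ := fun z b => 2 * inner ℝ e (p - b) + ‖p - b‖ ^ 2 * (2 * z)
  have hwc : Continuous fun y : ℂ × Rn 3 => w y.1 y.2 := by fun_prop
  have hwc' : Continuous fun y : ℂ × Rn 3 => w' y.1 y.2 := by fun_prop
  have hwd : ∀ z b, HasDerivAt (fun z => 1 + w z b) (w' z b) z := by
    intro z b
    have h1 := (hasDerivAt_id z).const_mul (2 * inner ℝ e (p - b) : ℂ)
    have h2 := (hasDerivAt_pow 2 z).const_mul (‖p - b‖ ^ 2 : ℂ)
    simpa [w, w'] using (h1.add h2).const_add 1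
  let G : ℂ → ℂ := fun z => ∫ b, (ρ b : ℂ) • (1 + w z b) ^ (-(1 / 2) : ℂ) ∂ν
  have hG : DifferentiableOn ℂ G (Metric.ball 0 (1 / (4 * B))) := by
    intro z hz
    refine (hasFDerivAt_integral_smul_of_continuousOn (𝕜 := ℂ) h.isCompact h.ae_mem
      h.integrable.ofReal Metric.isOpen_ball
      (Φ' := fun z b => ContinuousLinearMap.toSpanSingleton ℂ
        (-(1 / 2) * (1 + w z b) ^ (-(1 / 2) - 1 : ℂ) * w' z b))
      ?_ ?_ ?_ hz).differentiableAt.differentiableWithinAt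
    · intro z hz
      exact ContinuousOn.cpow_const
        (by fun_prop) (fun b hb => hw z hz b hb)
    · have : ContinuousOn (fun y : ℂ × Rn 3 => (1 + w y.1 y.2) ^ (-(1 / 2) - 1 : ℂ))
          (Metric.ball 0 (1 / (4 * B)) ×ˢ S) :=
        ContinuousOn.cpow_const (by fun_prop) (fun y hy => hw y.1 hy.1 y.2 hy.2)
      have h2 := (continuousOn_const (c := (-(1 / 2) : ℂ))).mul this |>.mul hwc'.continuousOn
      exact (ContinuousLinearMap.toSpanSingletonCLE (𝕜 := ℂ) (E := ℂ)).continuous.comp_continuousOn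
        h2
    · intro z hz b hb
      exact ((hwd z b).cpow_const (hw z hz b hb)).hasFDerivAt
  have hGa : AnalyticAt ℂ G 0 :=
    hG.analyticAt (Metric.ball_mem_nhds 0 (by positivity))
  obtain ⟨P, hP⟩ := hGa
  obtain ⟨ε, hε, hεP⟩ := Metric.eventually_nhds_iff_ball.1 (hasFPowerSeriesAt_iff.1 hP)
  refine ⟨ε, hε, fun n => (P.coeff n).re, fun x hx => ?_⟩
  have hs := hεP (x : ℂ) (by simpa using hx)
  have hGx : G (0 + (x : ℂ)) = ((∫ b, ρ b * ‖e + x • (p - b)‖⁻¹ ∂ν : ℝ) : ℂ) := by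
    rw [zero_add]
    refine Eq.trans ?_ integral_ofReal
    refine integral_congr_ae (Filter.Eventually.of_forall fun b => ?_)
    simp only [smul_eq_mul, RCLike.ofReal_mul]
    exact congrArg (fun y => (ρ b : ℂ) * y) (ofReal_inv_norm_add_smul he (p - b) x).symm
  rw [hGx] at hs
  have := Complex.hasSum_re hs
  simp only [smul_eq_mul, ← Complex.ofReal_pow, Complex.re_ofReal_mul, Complex.ofReal_re] at this
  simpa only [mul_comm] using this

theorem IsSource.analyticAtInfinity_line {ν : Measure (Rn 3)} {S W : Set (Rn 3)} {ρ F : Rn 3 → ℝ}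
    (h : IsSource ν S ρ) (hF : Set.EqOn F (layer ν ρ kernel) Sᶜ) (hWc : IsClosed W)
    (hWb : Bornology.IsBounded W) (hFs : ContDiffOn ℝ ∞ F Wᶜ) (i : Fin 3) (q : Rn 2) :
    AnalyticAtInfinity (lineSet i q W) (line i q F) := by
  obtain ⟨ε, hε, a, ha⟩ := h.exists_hasSum (ins i 0 q) (EuclideanSpace.single i (1 : ℝ))
    (by simp)
  obtain ⟨r, hr0, hr⟩ := (hWb.union h.isCompact.isBounded).exists_pos_norm_le
  have key : ∀ x : ℝ, x ≠ 0 → |x| < min ε (1 / r) → 1 / x ∉ lineSet i q W ∧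
      HasSum (fun n => a n * (|x| * x ^ n)) (line i q F (1 / x)) := by
    intro x hx hxε
    have hnot : ins i (1 / x) q ∉ W ∪ S := fun hm => by
      have h1 := (abs_le_norm_ins i (1 / x) q).trans (hr _ hm)
      have h2 := hxε.trans_le (min_le_right _ _)
      rw [abs_div, abs_one, div_le_iff₀ (abs_pos.2 hx)] at h1
      rw [lt_div_iff₀ hr0] at h2
      linarith
    refine ⟨fun hm => hnot (Or.inl hm), ?_⟩
    have hline : line i q F (1 / x) = |x| *
        ∫ b, ρ b * ‖EuclideanSpace.single i (1 : ℝ) + x • (ins i 0 q - b)‖⁻¹ ∂ν := by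
      rw [line, hF fun hm => hnot (Or.inr hm), layer, ← integral_const_mul]
      refine integral_congr_ae (Filter.Eventually.of_forall fun b => ?_)
      have hins : ins i (1 / x) q - b =
          (ins i 0 q - b) + x⁻¹ • EuclideanSpace.single i (1 : ℝ) := by
        rw [sub_add_eq_add_sub, ins_add_smul_single, zero_add, one_div]
      simp only [smul_eq_mul, kernel]
      rw [hins, norm_add_inv_smul hx]
      ring
    rw [hline]
    simpa only [mul_left_comm |x|] using (ha x (hxε.trans_le (min_le_left _ _))).mul_left |x|
  have hpos : 0 < min ε (1 / r) := by positivity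
  refine ⟨isClosed_lineSet i q hWc, isBounded_lineSet i q hWb, contDiffOn_line i q hFs,
    ⟨_, hpos, a, fun x hx hxε => ?_⟩, ⟨_, hpos, fun n => -a n, fun x hxε hx => ?_⟩⟩
  · simpa only [abs_of_pos hx, pow_succ'] using key x hx.ne' (by rwa [abs_of_pos hx])
  · simpa only [abs_of_neg hx, pow_succ', neg_mul, mul_neg] using
      key x hx.ne (by rw [abs_of_neg hx]; linarith)

/-! ### Derivatives of the kernel along a line -/

open Polynomial in
/-- The numerator of the `k`-th derivative of `(u² + 1)^(-1/2)`. -/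
def numer : ℕ → ℝ[X]
  | 0 => 1
  | k + 1 => derivative (numer k) * (X ^ 2 + 1) - C (2 * k + 1 : ℝ) * X * numer k

open Polynomial in
theorem natDegree_numer_le (k : ℕ) : (numer k).natDegree ≤ k := by
  induction k with
  | zero => simp [numer]
  | succ k ih =>
    have h1 : (derivative (numer k)).natDegree ≤ k - 1 :=
      (natDegree_derivative_le _).trans (Nat.sub_le_sub_right ih 1)
    rw [numer]
    rcases Nat.eq_zero_or_pos k with rfl | hk
    · simp [numer]
    refine (natDegree_sub_le _ _).trans (max_le ?_ ?_)
    · have h2 : (X ^ 2 + 1 : ℝ[X]).natDegree ≤ 2 := by compute_degree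
      refine (natDegree_mul_le_of_le h1 h2).trans (by omega)
    · have h2 : (C (2 * k + 1 : ℝ) * X : ℝ[X]).natDegree ≤ 1 := by compute_degree
      exact (natDegree_mul_le_of_le h2 ih).trans (by omega)

open Polynomial in
theorem coeff_numer_self (k : ℕ) : (numer k).coeff k = (-1) ^ k * k.factorial := by
  induction k with
  | zero => simp [numer]
  | succ k ih =>
    have h0 : (numer k).coeff (k + 1 + 1) = 0 :=
      coeff_eq_zero_of_natDegree_lt ((natDegree_numer_le k).trans_lt (by omega))
    have h1 : (derivative (numer k) * X ^ 2).coeff (k + 1) = k * (numer k).coeff k := by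
      rcases k with _ | k
      · simp [numer]
      · rw [show k + 1 + 1 = k + 2 from rfl, coeff_mul_X_pow, coeff_derivative]
        push_cast
        ring
    rw [numer, coeff_sub, mul_add, coeff_add, h1, mul_one, coeff_derivative, h0, mul_assoc,
      coeff_C_mul, coeff_X_mul, ih, pow_succ, Nat.factorial_succ]
    push_cast
    ring

theorem numer_ne_zero (k : ℕ) : numer k ≠ 0 := by
  intro h
  have := coeff_numer_self k
  rw [h, Polynomial.coeff_zero] at this
  have h2 : ((-1 : ℝ)) ^ k * k.factorial ≠ 0 :=
    mul_ne_zero (pow_ne_zero _ (by norm_num)) (by exact_mod_cast k.factorial_ne_zero)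
  exact h2 this.symm

theorem iteratedDeriv_rpow_sq_add_one (k : ℕ) :
    iteratedDeriv k (fun u : ℝ => (u ^ 2 + 1) ^ (-(1 / 2) : ℝ)) =
      fun u => (numer k).eval u * (u ^ 2 + 1) ^ (-(1 / 2) - k : ℝ) := by
  induction k with
  | zero => simp [numer]
  | succ k ih =>
    rw [iteratedDeriv_succ, ih]
    funext u
    have hpos : 0 < u ^ 2 + 1 := by positivity
    have h1 : HasDerivAt (fun u : ℝ => u ^ 2 + 1) (2 * u) u := by
      simpa using (hasDerivAt_pow 2 u).add_const 1
    have h2 := ((numer k).hasDerivAt u).mul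
      (h1.rpow_const (p := -(1 / 2) - k) (Or.inl hpos.ne'))
    have h3 : (u ^ 2 + 1) ^ (-(1 / 2) - k : ℝ) =
        (u ^ 2 + 1) * (u ^ 2 + 1) ^ (-(1 / 2) - k - 1 : ℝ) := by
      rw [Real.rpow_sub_one hpos.ne']
      field_simp
    rw [show (fun u => (numer k).eval u * (u ^ 2 + 1) ^ (-(1 / 2) - k : ℝ)) =
      (fun u => (numer k).eval u) * fun u : ℝ => (u ^ 2 + 1) ^ (-(1 / 2) - k : ℝ) from rfl,
      h2.deriv, h3, numer]
    simp only [Polynomial.eval_sub, Polynomial.eval_mul, Polynomial.eval_add, Polynomial.eval_pow,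
      Polynomial.eval_X, Polynomial.eval_one, Polynomial.eval_C]
    rw [show (-(1 / 2) - ((k + 1 : ℕ) : ℝ)) = -(1 / 2) - k - 1 by push_cast; ring]
    ring

theorem contDiff_rpow_sq_add_one {n : WithTop ℕ∞} :
    ContDiff ℝ n (fun u : ℝ => (u ^ 2 + 1) ^ (-(1 / 2) : ℝ)) :=
  ContDiff.rpow_const_of_ne (by fun_prop) fun u => by positivity

theorem line_kernel_eq (i : Fin 3) {w : Rn 2} (hw : w ≠ 0) :
    line i w kernel = fun u => ‖w‖⁻¹ * ((‖w‖⁻¹ * u) ^ 2 + 1) ^ (-(1 / 2) : ℝ) := by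
  funext u
  have hw' : 0 < ‖w‖ := norm_pos_iff.2 hw
  have h : ‖ins i u w‖ = ‖w‖ * √((‖w‖⁻¹ * u) ^ 2 + 1) := by
    rw [← sq_eq_sq₀ (norm_nonneg _) (by positivity), norm_ins_sq, mul_pow,
      Real.sq_sqrt (by positivity)]
    field_simp
  rw [line, kernel, h, mul_inv, Real.rpow_neg (by positivity), Real.sqrt_eq_rpow]

/-- Off the axis, the zeros of the derivatives of the kernel in the direction of the axis form
finitely many cones. -/
theorem pderiv_iterate_kernel_eq_zero_iff (i : Fin 3) (k : ℕ) (u : ℝ) {w : Rn 2} (hw : w ≠ 0) :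
    (pderiv i)^[k] kernel (ins i u w) = 0 ↔ (numer k).IsRoot (‖w‖⁻¹ * u) := by
  have h : (pderiv i)^[k] kernel (ins i u w) = iteratedDeriv k (line i w kernel) u := by
    rw [iteratedDeriv_line, line]
  have hpos : ((‖w‖⁻¹ * u) ^ 2 + 1) ^ (-2⁻¹ - k : ℝ) ≠ 0 := by positivity
  rw [h, line_kernel_eq i hw, iteratedDeriv_const_mul_field,
    iteratedDeriv_comp_const_mul contDiff_rpow_sq_add_one, iteratedDeriv_rpow_sq_add_one]
  simp [hw, hpos]

theorem pderiv_iterate_kernel_axis_ne_zero (i : Fin 3) (k : ℕ) {u : ℝ} (hu : u ≠ 0) :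
    (pderiv i)^[k] kernel (ins i u 0) ≠ 0 := by
  have h : (pderiv i)^[k] kernel (ins i u 0) = iteratedDeriv k (line i 0 kernel) u := by
    rw [iteratedDeriv_line, line]
  have hl : line i 0 kernel = fun u => |u|⁻¹ := by
    funext u
    rw [line, kernel, ← sq_eq_sq₀ (by positivity) (by positivity), inv_pow, norm_ins_sq]
    simp
  have hinv : iteratedDeriv k (fun u : ℝ => u⁻¹) u ≠ 0 := by
    rw [iteratedDeriv_eq_iterate, iter_deriv_inv]
    exact mul_ne_zero (mul_ne_zero (pow_ne_zero _ (by norm_num))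
      (by exact_mod_cast k.factorial_ne_zero)) (zpow_ne_zero _ hu)
  rw [h, hl]
  rcases hu.lt_or_gt with hneg | hpos
  · have : (fun u : ℝ => |u|⁻¹) =ᶠ[nhds u] fun u => -u⁻¹ := by
      filter_upwards [gt_mem_nhds hneg] with v hv
      rw [abs_of_neg hv, inv_neg]
    rw [this.iteratedDeriv_eq, iteratedDeriv_fun_neg]
    exact neg_ne_zero.2 hinv
  · have : (fun u : ℝ => |u|⁻¹) =ᶠ[nhds u] fun u => u⁻¹ := by
      filter_upwards [lt_mem_nhds hpos] with v hv
      rw [abs_of_pos hv]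
    rwa [this.iteratedDeriv_eq]

/-! ### Point masses -/

theorem isSource_dirac (a : Rn 3) : IsSource (Measure.dirac a) {a} 1 where
  isCompact := isCompact_singleton
  ae_mem := by simp [ae_dirac_eq]
  integrable := integrable_const (1 : ℝ)

theorem layer_dirac (a : Rn 3) (φ : Rn 3 → ℝ) :
    layer (Measure.dirac a) 1 φ = fun p => φ (p - a) := by
  funext p
  simp [layer]

theorem encard_zeros_point_le (a : Rn 3) {s : ℝ} (hs : 0 < s) (i : Fin 3) (q : Rn 2) (k : ℕ) :
    (zeros (lineSet i q (Metric.closedBall a s)) (line i q fun p => 1 / ‖p - a‖) k).encard ≤ k := by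
  obtain ⟨b, hb⟩ := exists_eq_ins i a
  have hder : ∀ t, t ∉ lineSet i q (Metric.closedBall a s) →
      ins i t q ≠ a ∧ iteratedDeriv k (line i q fun p => 1 / ‖p - a‖) t =
        (pderiv i)^[k] kernel (ins i (t - a i) (q - b)) := by
    intro t ht
    have hta : ins i t q ≠ a := by
      intro h
      exact ht (by simp [lineSet, h, hs.le])
    refine ⟨hta, ?_⟩
    rw [iteratedDeriv_line, line, (isSource_dirac a).pderiv_iterate_layer contDiffOn_kernel
      (fun p _ => by simp [layer_dirac, kernel]) i k hta, layer_dirac, ← ins_sub_ins, ← hb]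
  by_cases hw : q - b = 0
  · have : zeros (lineSet i q (Metric.closedBall a s)) (line i q fun p => 1 / ‖p - a‖) k = ∅ := by
      refine Set.eq_empty_of_forall_notMem fun t ⟨ht, h0⟩ => ?_
      obtain ⟨hta, hd⟩ := hder t ht
      rw [hd, hw] at h0
      refine pderiv_iterate_kernel_axis_ne_zero i k (fun h => hta ?_) h0
      rw [hb, sub_eq_zero.1 hw, sub_eq_zero.1 h]
    rw [this, Set.encard_empty]
    exact zero_le
  · have hw' : ‖q - b‖ ≠ 0 := norm_ne_zero_iff.2 hw
    have hsub : zeros (lineSet i q (Metric.closedBall a s)) (line i q fun p => 1 / ‖p - a‖) k ⊆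
        (fun α => a i + ‖q - b‖ * α) '' ((numer k).roots.toFinset : Set ℝ) := by
      rintro t ⟨ht, h0⟩
      rw [(hder t ht).2, pderiv_iterate_kernel_eq_zero_iff i k _ hw] at h0
      refine ⟨_, by simpa [numer_ne_zero] using h0, ?_⟩
      simp [mul_inv_cancel_left₀ hw']
    refine (Set.encard_le_encard hsub).trans ((Set.encard_image_le _ _).trans ?_)
    rw [Set.encard_coe_eq_coe_finsetCard]
    exact_mod_cast (Multiset.toFinset_card_le _).trans
      ((Polynomial.card_roots' _).trans (natDegree_numer_le k))

theorem normal3_point (a : Rn 3) {s : ℝ} (hs : 0 < s) :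
    Normal3 (Metric.closedBall a s) (fun p => 1 / ‖p - a‖) := by
  have hF : Set.EqOn (fun p => 1 / ‖p - a‖) (layer (Measure.dirac a) 1 kernel) {a}ᶜ :=
    fun p _ => by simp [layer_dirac, kernel]
  have hb : Base3 (Metric.closedBall a s) (fun p => 1 / ‖p - a‖) :=
    (isSource_dirac a).base3 Metric.isClosed_closedBall Metric.isBounded_closedBall
      (Set.singleton_subset_iff.2
        (Metric.ball_subset_interior_closedBall (Metric.mem_ball_self hs))) hF
  refine ⟨hb, fun i c => ⟨?_, 2, fun j e k hk => ?_⟩, 4, fun i q k hk => ?_⟩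
  · exact hb.base2_slice ((isSource_dirac a).analyticAtInfinity_line hF hb.isClosed hb.isBounded
      hb.smooth) i c
  · obtain ⟨q, -, h1, h2⟩ := exists_line_slice i j c e
    rw [h1, h2]
    exact (encard_zeros_point_le a hs _ q k).trans (by exact_mod_cast hk)
  · exact (encard_zeros_point_le a hs i q k).trans (by exact_mod_cast hk)

/-! ### Zeros of potentials of densities of constant sign -/

/-- `ρ` has constant sign and is not negligible. -/
def HasConstSign (ν : Measure (Rn 3)) (ρ : Rn 3 → ℝ) : Prop :=
  ((∀ a, 0 ≤ ρ a) ∨ ∀ a, ρ a ≤ 0) ∧ ¬ ρ =ᵐ[ν] 0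

theorem forall_pos_or_forall_neg_of_isPreconnected {X : Type*} [TopologicalSpace X] {C : Set X}
    (hC : IsPreconnected C) {f : X → ℝ} (hf : ContinuousOn f C) (h0 : ∀ a ∈ C, f a ≠ 0) :
    (∀ a ∈ C, 0 < f a) ∨ ∀ a ∈ C, f a < 0 := by
  by_contra! h
  obtain ⟨⟨a, ha, hfa⟩, b, hb, hfb⟩ := h
  obtain ⟨c, hc, hfc⟩ := hC.intermediate_value ha hb hf ⟨hfa, hfb⟩
  exact h0 c hc hfc

theorem integral_mul_ne_zero_of_pos {X : Type*} [MeasurableSpace X] {ν : Measure X}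
    {ρ f : X → ℝ} (hρ : ∀ a, 0 ≤ ρ a) (hρ0 : ¬ ρ =ᵐ[ν] 0) (hf : ∀ᵐ a ∂ν, 0 < f a)
    (hi : Integrable (fun a => ρ a * f a) ν) : ∫ a, ρ a * f a ∂ν ≠ 0 := by
  intro h
  rw [integral_eq_zero_iff_of_nonneg_ae
    (hf.mono fun a ha => mul_nonneg (hρ a) ha.le) hi] at h
  refine hρ0 ?_
  filter_upwards [h, hf] with a h1 h2
  exact (mul_eq_zero.1 h1).resolve_right h2.ne'

theorem IsSource.exists_mem_eq_zero {ν : Measure (Rn 3)} {S C : Set (Rn 3)} {ρ f : Rn 3 → ℝ}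
    (h : IsSource ν S ρ) (hs : HasConstSign ν ρ) (hSC : S ⊆ C) (hC : IsPreconnected C)
    (hf : ContinuousOn f C) (h0 : ∫ a, ρ a * f a ∂ν = 0) : ∃ a ∈ C, f a = 0 := by
  by_contra! hne
  have hi : Integrable (fun a => ρ a * f a) ν :=
    integrable_smul_of_continuousOn h.isCompact h.ae_mem h.integrable (hf.mono hSC)
  have hae : ∀ {P : Rn 3 → Prop}, (∀ a ∈ C, P a) → ∀ᵐ a ∂ν, P a := fun hP =>
    h.ae_mem.mono fun a ha => hP a (hSC ha)
  have hneg : ¬ (fun a => -ρ a) =ᵐ[ν] 0 := fun h' => hs.2 (h'.mono fun a ha => neg_eq_zero.1 ha)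
  have h0' : ∫ a, -ρ a * f a ∂ν = 0 := by simp [neg_mul, integral_neg, h0]
  have h0n : ∫ a, ρ a * -f a ∂ν = 0 := by simp [mul_neg, integral_neg, h0]
  have h0nn : ∫ a, -ρ a * -f a ∂ν = 0 := by simp [h0]
  rcases hs.1 with hp | hn <;>
    rcases forall_pos_or_forall_neg_of_isPreconnected hC hf hne with hfp | hfn
  · exact integral_mul_ne_zero_of_pos hp hs.2 (hae hfp) hi h0
  · exact integral_mul_ne_zero_of_pos hp hs.2 (hae fun a ha => neg_pos.2 (hfn a ha))
      (by simpa using hi.neg) h0n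
  · exact integral_mul_ne_zero_of_pos (fun a => neg_nonneg.2 (hn a)) hneg (hae hfp)
      (by simpa using hi.neg) h0'
  · exact integral_mul_ne_zero_of_pos (fun a => neg_nonneg.2 (hn a)) hneg
      (hae fun a ha => neg_pos.2 (hfn a ha)) (by simpa using hi) h0nn

/-- Along a line far from the source, the zeros of the derivatives of the potential are close to
those for a point source. -/
theorem IsSource.exists_root_of_iteratedDeriv_eq_zero {ν : Measure (Rn 3)} {S : Set (Rn 3)}
    {ρ F : Rn 3 → ℝ} (h : IsSource ν S ρ) (hs : HasConstSign ν ρ)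
    (hF : Set.EqOn F (layer ν ρ kernel) Sᶜ) {r : ℝ} (hr : S ⊆ Metric.closedBall 0 r)
    (i : Fin 3) {q : Rn 2} (hq : r < ‖q‖) {k : ℕ} {t : ℝ}
    (h0 : iteratedDeriv k (line i q F) t = 0) :
    ∃ α, (numer k).IsRoot α ∧ |t - α * ‖q‖| ≤ (1 + |α|) * r := by
  have hball : ins i t q ∉ Metric.closedBall (0 : Rn 3) r := by
    rw [mem_closedBall_zero_iff, not_le]
    exact hq.trans_le (norm_le_norm_ins i t q)
  have hC := contDiffOn_pderiv_iterate isOpen_compl_singleton contDiffOn_kernel i k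
  rw [iteratedDeriv_line, line, h.pderiv_iterate_layer contDiffOn_kernel hF i k
    (fun hm => hball (hr hm)), layer] at h0
  obtain ⟨a, ha, ha0⟩ := h.exists_mem_eq_zero hs hr (convex_closedBall _ _).isPreconnected
    (continuousOn_comp_const_sub hC.continuousOn hball) h0
  obtain ⟨b, hb⟩ := exists_eq_ins i a
  rw [mem_closedBall_zero_iff] at ha
  have hai : |a i| ≤ r := (abs_le_norm_ins i (a i) b).trans (hb ▸ ha)
  have hbr : ‖b‖ ≤ r := (norm_le_norm_ins i (a i) b).trans (hb ▸ ha)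
  have hqb : q - b ≠ 0 := fun h => by
    rw [sub_eq_zero.1 h] at hq
    linarith
  rw [hb, ins_sub_ins, pderiv_iterate_kernel_eq_zero_iff i k _ hqb] at ha0
  refine ⟨_, ha0, ?_⟩
  generalize hα : ‖q - b‖⁻¹ * (t - a i) = α
  have ht : t = a i + α * ‖q - b‖ := by
    rw [← hα, mul_right_comm, inv_mul_cancel₀ (norm_ne_zero_iff.2 hqb)]
    ring
  have hd : |‖q - b‖ - ‖q‖| ≤ r := by
    have := abs_norm_sub_norm_le (q - b) q
    rw [sub_sub_cancel_left, norm_neg] at this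
    exact this.trans hbr
  calc |t - α * ‖q‖| = |a i + α * (‖q - b‖ - ‖q‖)| := by rw [ht]; ring_nf
    _ ≤ |a i| + |α| * |‖q - b‖ - ‖q‖| := by rw [← abs_mul]; exact abs_add_le _ _
    _ ≤ r + |α| * r := by gcongr
    _ = (1 + |α|) * r := by ring

theorem IsSource.zerosInIntervals {ν : Measure (Rn 3)} {S : Set (Rn 3)} {ρ F : Rn 3 → ℝ}
    (h : IsSource ν S ρ) (hs : HasConstSign ν ρ) (hF : Set.EqOn F (layer ν ρ kernel) Sᶜ)
    (W : Set (Rn 3)) : ZerosInIntervals W F := by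
  obtain ⟨r, hr0, hr⟩ := h.isCompact.isBounded.subset_closedBall_lt 0 0
  let T : Finset ℝ := (Finset.range 5).biUnion fun k => (numer k).roots.toFinset
  let α : Fin T.card → ℝ := fun m => (T.equivFin.symm m : ℝ)
  refine ⟨r, ∑ m, 2 * ((1 + |α m|) * r), T.card, fun i q hq =>
    ⟨fun m => α m * ‖q‖ - (1 + |α m|) * r, fun m => α m * ‖q‖ + (1 + |α m|) * r,
      fun m => ?_, le_of_eq (Finset.sum_congr rfl fun m _ => by ring), ?_⟩⟩
  · have : 0 ≤ (1 + |α m|) * r := by positivity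
    linarith
  · rintro k hk t ⟨-, ht⟩
    obtain ⟨β, hβ, hβt⟩ := h.exists_root_of_iteratedDeriv_eq_zero hs hF hr i hq ht
    have hβT : β ∈ T := Finset.mem_biUnion.2
      ⟨k, Finset.mem_range.2 (by omega), by simpa [numer_ne_zero] using hβ⟩
    refine Set.mem_iUnion.2 ⟨T.equivFin ⟨β, hβT⟩, ?_⟩
    have hα : α (T.equivFin ⟨β, hβT⟩) = β := by simp [α]
    rw [abs_le] at hβt
    simp only [Set.mem_Icc, hα]
    constructor <;> linarith [hβt.1, hβt.2]

theorem exists_root_numer_eq_or_neg {k : ℕ} (hk : k ≤ 2) : ∃ A : ℝ, 0 ≤ A ∧ A ≤ 1 ∧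
    ∀ α, (numer k).IsRoot α → α = A ∨ α = -A := by
  interval_cases k
  · exact ⟨0, le_rfl, zero_le_one, fun α h => by simp [numer] at h⟩
  · exact ⟨0, le_rfl, zero_le_one, fun α h => by simpa [numer] using h⟩
  · refine ⟨√(1 / 2), Real.sqrt_nonneg _, Real.sqrt_le_one.2 (by norm_num), fun α h => ?_⟩
    rw [← sq_eq_sq_iff_eq_or_eq_neg, Real.sq_sqrt (by norm_num)]
    simp [numer, Polynomial.IsRoot] at h
    linarith

theorem IsSource.quasiNormal2_slice {ν : Measure (Rn 3)} {S W : Set (Rn 3)} {ρ F : Rn 3 → ℝ}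
    (h : IsSource ν S ρ) (hs : HasConstSign ν ρ) (hF : Set.EqOn F (layer ν ρ kernel) Sᶜ)
    (hb : Base3 W F) (i : Fin 3) (c : ℝ) : QuasiNormal2 (sliceSet i c W) (slice i c F) := by
  obtain ⟨r, hr0, hr⟩ := h.isCompact.isBounded.subset_closedBall_lt 0 0
  refine ⟨hb.base2_slice (h.analyticAtInfinity_line hF hb.isClosed hb.isBounded hb.smooth) i c,
    r, 4 * r + 2, fun j e he k hk => ?_⟩
  obtain ⟨q, hqn, h1, h2⟩ := exists_line_slice i j c e
  obtain ⟨A, hA0, hA1, hA⟩ := exists_root_numer_eq_or_neg hk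
  have hq : r < ‖q‖ := by
    refine he.trans_le (abs_le.2 (abs_le_of_sq_le_sq' ?_ (norm_nonneg _)))
    nlinarith [sq_nonneg c]
  have hAr : A * r ≤ r := mul_le_of_le_one_left hr0.le hA1
  have hAr0 : 0 ≤ A * r := by positivity
  refine ⟨A * ‖q‖ + ((1 + A) * r + 1), A * ‖q‖ - ((1 + A) * r + 1), by linarith, by linarith, ?_⟩
  rw [h1, h2]
  rintro t ⟨-, ht⟩
  obtain ⟨β, hβ, hβt⟩ := h.exists_root_of_iteratedDeriv_eq_zero hs hF hr _ hq ht
  rw [abs_le] at hβt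
  rcases hA β hβ with rfl | rfl
  · rw [abs_of_nonneg hA0] at hβt
    exact Or.inr ⟨by linarith [hβt.1], by linarith [hβt.2]⟩
  · rw [abs_neg, abs_of_nonneg hA0] at hβt
    exact Or.inl ⟨by linarith [hβt.1], by linarith [hβt.2]⟩

theorem IsSource.quasiNormal3 {ν : Measure (Rn 3)} {S W : Set (Rn 3)} {ρ F : Rn 3 → ℝ}
    (h : IsSource ν S ρ) (hs : HasConstSign ν ρ) (hF : Set.EqOn F (layer ν ρ kernel) Sᶜ)
    (hWc : IsClosed W) (hWb : Bornology.IsBounded W) (hW : S ⊆ interior W) : QuasiNormal3 W F :=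
  have hb := h.base3 hWc hWb hW hF
  ⟨hb, h.quasiNormal2_slice hs hF hb, h.zerosInIntervals hs hF W⟩

/-! ### Newtonian potentials of continuous densities -/

theorem locallyIntegrable_kernel : LocallyIntegrable kernel volume := by
  rw [locallyIntegrable_iff]
  intro K hK
  obtain ⟨r, hr⟩ := hK.isBounded.subset_ball 0
  refine IntegrableOn.mono_set ?_ hr
  refine (integrableOn_fun_norm_addHaar volume (f := fun y : ℝ => y⁻¹)).2 ?_
  have h : IntegrableOn (fun y : ℝ => y) (Set.Ioo 0 r) :=
    (continuous_id.integrableOn_Icc (a := 0) (b := r)).mono_set Set.Ioo_subset_Icc_self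
  refine h.congr_fun (fun y hy => ?_) measurableSet_Ioo
  have : y ≠ 0 := hy.1.ne'
  simp only [finrank_euclideanSpace, Fintype.card_fin, smul_eq_mul]
  field_simp

theorem potential_eq_convolution (ρ : Rn 3 → ℝ) :
    potential ρ = convolution ρ kernel (ContinuousLinearMap.lsmul ℝ ℝ) volume := by
  funext p
  simp [potential, convolution, kernel, div_eq_mul_inv]

variable {ρ : Rn 3 → ℝ}

theorem integrable_div_norm_sub (hc : Continuous ρ) (hs : HasCompactSupport ρ) (p : Rn 3) :
    Integrable fun p' : Rn 3 => ρ p' / ‖p - p'‖ := by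
  have h := hs.convolutionExists_left (ContinuousLinearMap.lsmul ℝ ℝ) hc
    locallyIntegrable_kernel p
  simpa [ConvolutionExistsAt, kernel, div_eq_mul_inv] using h

theorem contDiff_potential (hc : ContDiff ℝ ∞ ρ) (hs : HasCompactSupport ρ) :
    ContDiff ℝ ∞ (potential ρ) := by
  rw [potential_eq_convolution]
  exact hs.contDiff_convolution_left (ContinuousLinearMap.lsmul ℝ ℝ) hc locallyIntegrable_kernel

theorem isSource_restrict_tsupport (hc : Continuous ρ) (hs : HasCompactSupport ρ) :
    IsSource (volume.restrict (tsupport ρ)) (tsupport ρ) ρ where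
  isCompact := hs
  ae_mem := ae_restrict_mem (isClosed_tsupport ρ).measurableSet
  integrable := (hc.integrable_of_hasCompactSupport hs).restrict

theorem potential_eq_layer (ρ : Rn 3 → ℝ) :
    potential ρ = layer (volume.restrict (tsupport ρ)) ρ kernel := by
  funext p
  rw [layer, setIntegral_eq_integral_of_forall_compl_eq_zero]
  · simp [potential, kernel, div_eq_mul_inv]
  · intro a ha
    rw [image_eq_zero_of_notMem_tsupport ha, zero_smul]

theorem hasConstSign_restrict_tsupport (hc : Continuous ρ)
    (hsgn : (∀ a, 0 ≤ ρ a) ∨ ∀ a, ρ a ≤ 0) (h0 : ρ ≠ 0) :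
    HasConstSign (volume.restrict (tsupport ρ)) ρ := by
  refine ⟨hsgn, fun h => h0 ?_⟩
  have h1 : ρ =ᵐ[volume] 0 := by
    filter_upwards [(ae_restrict_iff' (isClosed_tsupport ρ).measurableSet).1 h] with a ha
    by_cases hm : a ∈ tsupport ρ
    exacts [ha hm, image_eq_zero_of_notMem_tsupport hm]
  exact (hc.ae_eq_iff_eq volume continuous_const).1 h1

/-! ### Densities of arbitrary sign -/

theorem ModerateDecrease.of_continuous {d n : ℕ} {W : Set (Rn d)} {f : Rn d → ℝ}
    (h : ModerateDecrease n W f) (hW : Bornology.IsBounded W) (hf : Continuous f) :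
    ModerateDecrease n ∅ f := by
  obtain ⟨C, hC, h⟩ := h
  obtain ⟨r, hr⟩ := hW.subset_closedBall (0 : Rn d)
  obtain ⟨B, hB⟩ := (isCompact_closedBall (0 : Rn d) r).exists_bound_of_continuousOn
    (f := fun p => ‖p‖ ^ n * f p) (by fun_prop)
  refine ⟨max C B, lt_max_of_lt_left hC, fun p _ hp => ?_⟩
  have hp0 : 0 < ‖p‖ := by linarith
  by_cases hpW : p ∈ W
  · have := hB p (hr hpW)
    rw [norm_mul, norm_pow, norm_norm, Real.norm_eq_abs] at this
    rw [le_div_iff₀ (by positivity), mul_comm]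
    exact this.trans (le_max_right _ _)
  · refine (h p hpW hp).trans ?_
    gcongr
    exact le_max_left _ _

theorem Base3.of_contDiff {W : Set (Rn 3)} {f : Rn 3 → ℝ} (h : Base3 W f)
    (hf : ContDiff ℝ ∞ f) : Base3 ∅ f := by
  have hf' := contDiffOn_univ.2 hf
  refine ⟨isClosed_empty, Bornology.isBounded_empty, hf.contDiffOn,
    h.decrease.of_continuous h.isBounded hf.continuous, fun i j k hijk =>
    (h.decrease_pderiv i j k hijk).of_continuous h.isBounded ?_⟩
  exact (contDiffOn_univ.1 (contDiffOn_pderiv_iterate isOpen_univ (contDiffOn_pderiv_iterate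
    isOpen_univ (contDiffOn_pderiv_iterate isOpen_univ hf' 2 k) 1 j) 0 i)).continuous

/-- A continuous density is a sum of densities of constant sign. -/
theorem exists_add_of_constSign (hc : Continuous ρ) (hs : HasCompactSupport ρ) (h0 : ρ ≠ 0) :
    ∃ ρ₁ ρ₂ : Rn 3 → ℝ, (Continuous ρ₁ ∧ HasCompactSupport ρ₁ ∧ (∀ a, 0 ≤ ρ₁ a) ∧ ρ₁ ≠ 0) ∧
      (Continuous ρ₂ ∧ HasCompactSupport ρ₂ ∧ (∀ a, ρ₂ a ≤ 0) ∧ ρ₂ ≠ 0) ∧ ρ = ρ₁ + ρ₂ := by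
  obtain ⟨a, ha⟩ := Function.ne_iff.1 h0
  have ha' : 0 < |ρ a| := abs_pos.2 ha
  refine ⟨fun a => 2 * |ρ a| + ρ a, fun a => -(2 * |ρ a|),
    ⟨by fun_prop, hs.comp_left (g := fun y => 2 * |y| + y) (by simp), fun a => ?_, fun h => ?_⟩,
    ⟨by fun_prop, hs.comp_left (g := fun y => -(2 * |y|)) (by simp), fun a => ?_, fun h => ?_⟩, ?_⟩
  · linarith [neg_abs_le (ρ a), abs_nonneg (ρ a)]
  · have := congrFun h a
    simp only [Pi.zero_apply] at this
    linarith [neg_abs_le (ρ a)]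
  · linarith [abs_nonneg (ρ a)]
  · have := congrFun h a
    simp only [Pi.zero_apply] at this
    linarith
  · funext a
    simp

theorem quasiSplitNormal3_potential (hc : ContDiff ℝ ∞ ρ) (hs : HasCompactSupport ρ)
    (h0 : ρ ≠ 0) : QuasiSplitNormal3 ∅ (potential ρ) := by
  obtain ⟨ρ₁, ρ₂, ⟨hc₁, hs₁, hn₁, h0₁⟩, ⟨hc₂, hs₂, hn₂, h0₂⟩, hρ⟩ :=
    exists_add_of_constSign hc.continuous hs h0
  have hadd : ∀ p, potential ρ p = potential ρ₁ p + potential ρ₂ p := fun p => by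
    rw [potential, potential, potential, ← integral_add (integrable_div_norm_sub hc₁ hs₁ p)
      (integrable_div_norm_sub hc₂ hs₂ p), hρ]
    simp only [Pi.add_apply, add_div]
  obtain ⟨r, hr⟩ := ((hs.isCompact.isBounded.union hs₁.isCompact.isBounded).union
    hs₂.isCompact.isBounded).subset_ball 0
  have hball := hr.trans Metric.ball_subset_interior_closedBall
  rw [Set.union_subset_iff, Set.union_subset_iff] at hball
  obtain ⟨⟨hball₀, hball₁⟩, hball₂⟩ := hball
  have hsrc := isSource_restrict_tsupport hc.continuous hs
  have heq : ∀ ρ : Rn 3 → ℝ, Set.EqOn (potential ρ)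
      (layer (volume.restrict (tsupport ρ)) ρ kernel) (tsupport ρ)ᶜ := fun ρ p _ =>
    congrFun (potential_eq_layer ρ) p
  have hb : Base3 ∅ (potential ρ) :=
    (hsrc.base3 Metric.isClosed_closedBall Metric.isBounded_closedBall hball₀ (heq ρ)).of_contDiff
      (contDiff_potential hc hs)
  have hq₁ : QuasiNormal3 (Metric.closedBall 0 r) (potential ρ₁) :=
    (isSource_restrict_tsupport hc₁ hs₁).quasiNormal3
      (hasConstSign_restrict_tsupport hc₁ (Or.inl hn₁) h0₁) (heq ρ₁)
      Metric.isClosed_closedBall Metric.isBounded_closedBall hball₁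
  have hq₂ : QuasiNormal3 (Metric.closedBall 0 r) (potential ρ₂) :=
    (isSource_restrict_tsupport hc₂ hs₂).quasiNormal3
      (hasConstSign_restrict_tsupport hc₂ (Or.inr hn₂) h0₂) (heq ρ₂)
      Metric.isClosed_closedBall Metric.isBounded_closedBall hball₂
  refine ⟨hb, fun i c => ⟨?_, sliceSet i c (Metric.closedBall 0 r), slice i c (potential ρ₁),
    slice i c (potential ρ₂), fun _ h => h.elim, hq₁.slice_quasiNormal i c,
    hq₂.slice_quasiNormal i c, fun q _ => hadd _⟩,
    Metric.closedBall 0 r, potential ρ₁, potential ρ₂, Set.empty_subset _,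
    Metric.isClosed_closedBall, Metric.isBounded_closedBall, hq₁.smooth, hq₂.smooth,
    hq₁.zeros_subset, hq₂.zeros_subset, fun p _ => hadd p⟩
  exact hb.base2_slice (hsrc.analyticAtInfinity_line (heq ρ) hb.isClosed hb.isBounded hb.smooth) i c

end

end Normality

theorem mainTheorem5 :
    (∀ (a : Normality.Rn 3) (s : ℝ), 0 < s →
      Normality.Normal3 (Metric.closedBall a s) (fun p => 1 / ‖p - a‖)) ∧
    (∀ ρ : Normality.Rn 3 → ℝ, Continuous ρ → HasCompactSupport ρ → (∀ p, 0 ≤ ρ p) → ρ ≠ 0 →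
      (∀ p, MeasureTheory.Integrable (fun p' : Normality.Rn 3 => ρ p' / ‖p - p'‖)) ∧
      ∀ W : Set (Normality.Rn 3), IsClosed W → Bornology.IsBounded W → tsupport ρ ⊆ interior W →
        Normality.QuasiNormal3 W (Normality.potential ρ)) ∧
    (∀ ρ : Normality.Rn 3 → ℝ, ContDiff ℝ ∞ ρ → HasCompactSupport ρ → ρ ≠ 0 →
      (∀ p, MeasureTheory.Integrable (fun p' : Normality.Rn 3 => ρ p' / ‖p - p'‖)) ∧
      Normality.QuasiSplitNormal3 ∅ (Normality.potential ρ)) := by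
  refine ⟨fun a s hs => Normality.normal3_point a hs, fun ρ hc hs hn h0 =>
    ⟨Normality.integrable_div_norm_sub hc hs, fun W hWc hWb hW => ?_⟩, fun ρ hc hs h0 =>
    ⟨Normality.integrable_div_norm_sub hc.continuous hs,
      Normality.quasiSplitNormal3_potential hc hs h0⟩⟩
  exact (Normality.isSource_restrict_tsupport hc hs).quasiNormal3
    (Normality.hasConstSign_restrict_tsupport hc (Or.inl hn) h0)
    (fun p _ => congrFun (Normality.potential_eq_layer ρ) p) hWc hWb hW
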